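/- All rings are commutative with $1$. For a field $F$ and $n\in\mathbb N$, let $F^{(n)}$ denote the field of fractions of the polynomial ring in $n$ variables over $F$; for an extension field $L$ of $F$, writing $L=F^{(n)}$ means that $L$ is $F$-isomorphic to this field. An extension of fields $L/E$ is called ruled if there is a field $F$ with $E\subseteq F\subseteq L$ and $L=F^{(1)}$. For a subring $A$ of an integral domain $B$, let $B_A=S^{-1}B$ where $S=A\setminus\{0\}$; it is an algebra over the field $\operatorname{Frac}A$. Let $\mathscr A_1^*(B)$ be the set of subrings $A$ of $B$ such that $A$ is algebraically closed in $B$ (every element of $B$ that is algebraic over $A$ lies in $A$) and $B_A$ is a polynomial ring in one variable over $\operatorname{Frac}A$. **Proposition.** Let $k$ be a field (of any characteristic) and let $B$ be an integral domain that is a $k$-algebra, such that $\operatorname{Frac}B$ has finite transcendence degree over $k$ and $|\mathscr A_1^*(B)|>1$. Then: (a) for each $A\in\mathscr A_1^*(B)$ we have $k\subseteq A$, and $\operatorname{Frac}A$ is ruled over $k$; (b) there exists a field $K$ with $k\subseteq K\subseteq\operatorname{Frac}B$ and $\operatorname{Frac}B=K^{(2)}$. -/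

import Mathlib

open scoped nonZeroDivisors

/-- `L = F^{(n)}`: the field `L` is `F`-isomorphic to the field of fractions of a polynomial ring
in `n` variables over its subfield `F`. -/
def IsRationalFunctionField (n : ℕ) (F L : Type*) [Field F] [Field L] [Algebra F L] : Prop :=
  Nonempty (L ≃ₐ[F] FractionRing (MvPolynomial (Fin n) F))

/-- The field extension `L / E` is ruled: `L = F^{(1)}` for some field `E ⊆ F ⊆ L`. -/
def IsRuled (E L : Type*) [Field E] [Field L] [Algebra E L] : Prop :=
  ∃ F : IntermediateField E L, IsRationalFunctionField 1 F L

/-- The ring `B_A = S⁻¹B`, where `S = A \ {0}`, for a subring `A` of a domain `B`. It is an algebra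
over `A_A = Frac A`, by Mathlib's instance for localizations of algebras. -/
abbrev locAt {B : Type*} [CommRing B] (A : Subring B) : Type _ :=
  Localization (Algebra.algebraMapSubmonoid B (A⁰))

/-- The set `𝒜₁*(B)` of subrings `A` of `B` such that `A` is algebraically closed in `B` and
`B_A` is a polynomial ring in one variable over the field `A_A = Frac A`. -/
def A1star (B : Type*) [CommRing B] : Set (Subring B) :=
  {A | (∀ b : B, IsAlgebraic A b → b ∈ A) ∧
    Nonempty (locAt A ≃ₐ[FractionRing A] Polynomial (FractionRing A))}

/-! Let `A ≠ A'` be two members, with `E = Frac A` and `K = Frac A'`. Then `Frac B = E(X) = K(Y)`,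
and `-deg_X` is a valuation with residue field `E`, realised by embedding `B` in the Laurent series
over `E` in `X⁻¹`. It is nontrivial on `K`: otherwise `A'` consists of elements of degree 0, so `A'
⊆ A`, and equality of transcendence degrees gives `A' = A` (`IsGenericLine.eq_of_le`). A valuation
nontrivial on `K` makes the residue field of `K` drop in transcendence degree
(`order_eq_zero_of_isAlgebraic_adjoin_residues`), while `E` and `K` have the same one. So the
algebraic closure `M` of that residue field in `E` is proper, and the ruled residue theorem for
`K(Y)` gives `E = M(θ)` (`exists_transcendental_adjoin_eq_top_of_residues`). This is (a), and `Frac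
B = M(θ, X)` is (b). -/

open Polynomial

/-! ### Orders and leading coefficients of Laurent series -/

namespace HahnSeries

section LeadingTerm

variable {E : Type*} [Field E]

theorem order_zpow_of_ne_zero {x : LaurentSeries E} (hx : x ≠ 0) (n : ℤ) :
    (x ^ n).order = n * x.order := by
  have h : ∀ m : ℕ, (x ^ m).order = m * x.order := fun m ↦ by simp
  cases n with
  | ofNat m => simp
  | negSucc m =>
    have h1 : x ^ (Int.negSucc m) * x ^ (m + 1) = 1 := by
      rw [zpow_negSucc, inv_mul_cancel₀ (pow_ne_zero _ hx)]
    have h2 := congrArg order h1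
    rw [order_mul (zpow_ne_zero _ hx) (pow_ne_zero _ hx), h, order_one] at h2
    rw [Int.negSucc_eq] at h2 ⊢
    push_cast at h2
    linarith

theorem leadingCoeff_pow' (x : LaurentSeries E) (n : ℕ) :
    (x ^ n).leadingCoeff = x.leadingCoeff ^ n := by
  induction n with
  | zero => simp
  | succ n ih => rw [pow_succ, leadingCoeff_mul, ih, pow_succ]

theorem leadingCoeff_zpow (x : LaurentSeries E) (n : ℤ) :
    (x ^ n).leadingCoeff = x.leadingCoeff ^ n := by
  rcases eq_or_ne x 0 with rfl | hx
  · rcases eq_or_ne n 0 with rfl | hn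
    · simp
    · simp [zero_zpow _ hn]
  cases n with
  | ofNat m => simp [leadingCoeff_pow']
  | negSucc m =>
    have h1 : x ^ (Int.negSucc m) * x ^ (m + 1) = 1 := by
      rw [zpow_negSucc, inv_mul_cancel₀ (pow_ne_zero _ hx)]
    have h2 := congrArg leadingCoeff h1
    rw [leadingCoeff_mul, leadingCoeff_pow', leadingCoeff_one] at h2
    rw [zpow_negSucc (leadingCoeff x)]
    exact eq_inv_of_mul_eq_one_left h2

theorem order_leadingCoeff_add_of_lt {x y : LaurentSeries E} (hx : x ≠ 0)
    (h : y = 0 ∨ x.order < y.order) :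
    (x + y).order = x.order ∧ (x + y).leadingCoeff = x.leadingCoeff := by
  rcases eq_or_ne y 0 with rfl | hy
  · simp
  have h' : x.orderTop < y.orderTop := by
    rw [← order_eq_orderTop_of_ne_zero hx, ← order_eq_orderTop_of_ne_zero hy]
    exact_mod_cast h.resolve_left hy
  have h1 := leadingCoeff_add_eq_left h'
  have h2 := orderTop_add_eq_left h'
  have h3 : x + y ≠ 0 := by rw [← leadingCoeff_ne_zero, h1]; exact leadingCoeff_ne_zero.2 hx
  rw [← order_eq_orderTop_of_ne_zero hx, ← order_eq_orderTop_of_ne_zero h3] at h2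
  exact ⟨by exact_mod_cast h2, h1⟩

theorem order_leadingCoeff_add_of_eq {x y : LaurentSeries E} (h : x.order = y.order)
    (h0 : x.leadingCoeff + y.leadingCoeff ≠ 0) :
    (x + y).order = x.order ∧
      (x + y).leadingCoeff = x.leadingCoeff + y.leadingCoeff := by
  have hc : (x + y).coeff x.order = x.leadingCoeff + y.leadingCoeff := by
    rw [coeff_add, leadingCoeff_eq, leadingCoeff_eq, h]
  have hne : x + y ≠ 0 := by
    intro h1
    rw [h1] at hc
    exact h0 hc.symm
  have ho : (x + y).order = x.order := by
    apply le_antisymm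
    · exact order_le_of_coeff_ne_zero (by rw [hc]; exact h0)
    · have := min_order_le_order_add hne
      rwa [← h, min_self] at this
  exact ⟨ho, by rw [leadingCoeff_eq, ho, hc]⟩

end LeadingTerm

end HahnSeries

/-! ### A root-closed group of leading terms -/

section PowerClass

variable {E : Type*} [Field E] (M : Subfield E) (N : ℕ) (b : E)

/-- The pair `(n, a)` lies in the subgroup of `ℤ × Eˣ` of those pairs whose image
`a ^ N / b ^ n` lies in the subfield `M`. -/
def InPowerClass (n : ℤ) (a : E) : Prop :=
  a ≠ 0 ∧ a ^ N / b ^ n ∈ M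

variable {M N b}

namespace InPowerClass

theorem mul (hb : b ≠ 0) {n n' : ℤ} {a a' : E} (h : InPowerClass M N b n a)
    (h' : InPowerClass M N b n' a') : InPowerClass M N b (n + n') (a * a') := by
  refine ⟨mul_ne_zero h.1 h'.1, ?_⟩
  rw [zpow_add₀ hb, mul_pow, mul_div_mul_comm]
  exact M.mul_mem h.2 h'.2

theorem inv {n : ℤ} {a : E} (h : InPowerClass M N b n a) :
    InPowerClass M N b (-n) a⁻¹ := by
  refine ⟨inv_ne_zero h.1, ?_⟩
  have := M.inv_mem h.2
  rwa [inv_div, ← inv_div_inv, ← inv_pow, ← zpow_neg] at this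

theorem one : InPowerClass M N b 0 1 := ⟨one_ne_zero, by simp⟩

theorem pow (hb : b ≠ 0) {n : ℤ} {a : E} (h : InPowerClass M N b n a) (j : ℕ) :
    InPowerClass M N b (j * n) (a ^ j) := by
  induction j with
  | zero => simpa using one
  | succ j ih =>
    have := ih.mul hb h
    rw [pow_succ]
    convert this using 1
    push_cast
    ring

theorem zpow (hb : b ≠ 0) {n : ℤ} {a : E} (h : InPowerClass M N b n a) (z : ℤ) :
    InPowerClass M N b (z * n) (a ^ z) := by
  cases z with
  | ofNat j => simpa using h.pow hb j
  | negSucc j =>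
    have := (h.pow hb (j + 1)).inv
    rw [zpow_negSucc, Int.negSucc_eq]
    convert this using 1
    push_cast
    ring

theorem of_mem {a : E} (ha : a ≠ 0) (h : a ∈ M) : InPowerClass M N b 0 a :=
  ⟨ha, by simpa using M.pow_mem h N⟩

theorem self (hb : b ≠ 0) : InPowerClass M N b N b :=
  ⟨hb, by rw [zpow_natCast, div_self (pow_ne_zero _ hb)]; exact M.one_mem⟩

/-- With `of_pow` below, this is where algebraic closedness of `M` enters: in order 0 the class is
exactly the nonzero part of `M`, and the class is closed under roots. -/
theorem mem (hM : ∀ x : E, IsAlgebraic M x → x ∈ M) (hN : 0 < N) {a : E}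
    (h : InPowerClass M N b 0 a) : a ∈ M := by
  have h2 : a ^ N ∈ M := by simpa using h.2
  apply hM
  have : IsAlgebraic M (a ^ N) := isAlgebraic_algebraMap (⟨_, h2⟩ : M)
  exact this.of_pow hN

theorem of_pow (hM : ∀ x : E, IsAlgebraic M x → x ∈ M) {n : ℤ} {a : E} (ha : a ≠ 0) {e : ℕ}
    (he : 0 < e) (h : InPowerClass M N b (e * n) (a ^ e)) : InPowerClass M N b n a := by
  refine ⟨ha, ?_⟩
  have h2 : (a ^ N / b ^ n) ^ e ∈ M := by
    have := h.2
    rwa [mul_comm, zpow_mul, zpow_natCast, ← pow_mul, mul_comm, pow_mul, ← div_pow] at this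
  apply hM
  have : IsAlgebraic M ((a ^ N / b ^ n) ^ e) := isAlgebraic_algebraMap (⟨_, h2⟩ : M)
  exact this.of_pow he

end InPowerClass

/-- The admissible `j` form a subgroup of `ℤ`, nonzero because `b ^ d` shows that it contains `N`;
`e` is its positive generator. -/
theorem exists_index_inPowerClass (hb : b ≠ 0) (hN : 0 < N) (d : ℤ) :
    ∃ (e : ℕ) (h : E), 0 < e ∧ InPowerClass M N b (e * d) h ∧
      ∀ (j : ℤ) (a : E), InPowerClass M N b (j * d) a → (e : ℤ) ∣ j := by
  let H : AddSubgroup ℤ :=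
    { carrier := {j | ∃ a, InPowerClass M N b (j * d) a}
      zero_mem' := ⟨1, by simpa using InPowerClass.one⟩
      add_mem' := by
        rintro x y ⟨a, ha⟩ ⟨a', ha'⟩
        exact ⟨a * a', by rw [add_mul]; exact ha.mul hb ha'⟩
      neg_mem' := by
        rintro x ⟨a, ha⟩
        exact ⟨a⁻¹, by rw [neg_mul]; exact ha.inv⟩ }
  obtain ⟨g, hg⟩ := Int.subgroup_cyclic H
  have hmem : ∀ j, j ∈ H ↔ g ∣ j := fun j ↦ by
    rw [hg, AddSubgroup.mem_closure_singleton]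
    exact ⟨fun ⟨z, hz⟩ ↦ ⟨z, by rw [← hz, smul_eq_mul, mul_comm]⟩,
      fun ⟨z, hz⟩ ↦ ⟨z, by rw [hz, smul_eq_mul, mul_comm]⟩⟩
  have hNH : (N : ℤ) ∈ H := ⟨b ^ d, by rw [mul_comm]; exact (InPowerClass.self hb).zpow hb d⟩
  have hg0 : g ≠ 0 := by
    rintro rfl
    have := (hmem _).1 hNH
    rw [zero_dvd_iff] at this
    omega
  have hgH : ((g.natAbs : ℕ) : ℤ) ∈ H := (hmem _).2 (Int.dvd_natAbs.2 dvd_rfl)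
  obtain ⟨h, hh⟩ := hgH
  exact ⟨g.natAbs, h, Int.natAbs_pos.2 hg0, hh,
    fun j a hj ↦ Int.natAbs_dvd.2 ((hmem j).1 ⟨a, hj⟩)⟩

end PowerClass

/-! ### The ruled residue theorem -/

section RuledResidue

variable {K E : Type*} [Field K] [Field E]

open HahnSeries in
/-- A special case of the ruled residue theorem: let `φ` embed `K[X]` into the field of Laurent
series over `E` such that `K` has nontrivial value group and `E` is the residue field of `K(X)`.
A proper subfield `M` of `E`, algebraically closed in `E` and containing the residues of `K`,
satisfies `E = M(θ)` for some transcendental `θ`. -/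
theorem exists_transcendental_adjoin_eq_top_of_residues (φ : K[X] →+* LaurentSeries E)
    (hφ : Function.Injective φ) (M : Subfield E) (hM : ∀ x : E, IsAlgebraic M x → x ∈ M)
    (hres : ∀ c : K, c ≠ 0 → (φ (C c)).order = 0 → (φ (C c)).leadingCoeff ∈ M)
    (hval : ∃ c : K, (φ (C c)).order ≠ 0)
    (hE : ∀ x : E, ∃ p q : K[X], q ≠ 0 ∧ φ p = HahnSeries.C x * φ q)
    (hne : M ≠ ⊤) :
    ∃ θ : E, Transcendental M θ ∧ IntermediateField.adjoin M {θ} = ⊤ := by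
  classical
  have hφ0 : ∀ {p : K[X]}, p ≠ 0 → φ p ≠ 0 := fun hp ↦ (map_ne_zero_iff φ hφ).2 hp
  have hl0 : ∀ {p : K[X]}, p ≠ 0 → (φ p).leadingCoeff ≠ 0 :=
    fun hp ↦ leadingCoeff_ne_zero.2 (hφ0 hp)
  obtain ⟨c₀, N, hc₀, hN, hcN⟩ :
      ∃ (c₀ : K) (N : ℕ), c₀ ≠ 0 ∧ 0 < N ∧ (φ (C c₀)).order = N := by
    obtain ⟨c, hc⟩ := hval
    have hc0 : c ≠ 0 := by rintro rfl; simp at hc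
    rcases lt_or_gt_of_ne hc with h | h
    · refine ⟨c⁻¹, (φ (C c)).order.natAbs, inv_ne_zero hc0, Int.natAbs_pos.2 hc, ?_⟩
      have : φ (C c⁻¹) = (φ (C c)) ^ (-1 : ℤ) := by
        rw [zpow_neg_one]; exact map_inv₀ (φ.comp C) c
      rw [this, order_zpow_of_ne_zero (hφ0 (C_ne_zero.2 hc0))]
      omega
    · exact ⟨c, (φ (C c)).order.natAbs, hc0, Int.natAbs_pos.2 hc, by omega⟩
  set b : E := (φ (C c₀)).leadingCoeff with hbdef
  have hb : b ≠ 0 := hl0 (C_ne_zero.2 hc₀)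
  let T : K[X] → Prop := fun p ↦ InPowerClass M N b (φ p).order (φ p).leadingCoeff
  -- Dividing the `N`-th power of `c` by the matching power of `c₀` gives an element of `K` of order
  -- 0, whose residue lies in `M`.
  have hTC : ∀ c : K, c ≠ 0 → T (C c) := by
    intro c hc
    have hcC := hφ0 (C_ne_zero.2 hc)
    refine ⟨hl0 (C_ne_zero.2 hc), ?_⟩
    have h1 : φ (C (c ^ N * c₀ ^ (-(φ (C c)).order))) =
        φ (C c) ^ N * φ (C c₀) ^ (-(φ (C c)).order) := by
      have := map_mul (φ.comp C) (c ^ N) (c₀ ^ (-(φ (C c)).order))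
      rwa [map_pow, map_zpow₀] at this
    have h2 := hres (c ^ N * c₀ ^ (-(φ (C c)).order))
      (mul_ne_zero (pow_ne_zero _ hc) (zpow_ne_zero _ hc₀))
    rw [h1, order_mul (pow_ne_zero _ hcC) (zpow_ne_zero _ (hφ0 (C_ne_zero.2 hc₀))),
      order_zpow_of_ne_zero (hφ0 (C_ne_zero.2 hc₀)), order_pow, hcN, HahnSeries.leadingCoeff_mul,
      HahnSeries.leadingCoeff_pow', leadingCoeff_zpow, zpow_neg, ← div_eq_mul_inv] at h2
    exact h2 (by rw [nsmul_eq_mul]; ring)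
  have hquot : ∀ x : E, x ≠ 0 → ∃ p q : K[X], p ≠ 0 ∧ q ≠ 0 ∧ (φ p).order = (φ q).order ∧
      (φ p).leadingCoeff = x * (φ q).leadingCoeff := by
    intro x hx
    obtain ⟨p, q, hq, hpq⟩ := hE x
    have hx' : (HahnSeries.C x : LaurentSeries E) ≠ 0 := HahnSeries.C_ne_zero hx
    have hp : p ≠ 0 := by
      rintro rfl
      rw [map_zero] at hpq
      exact mul_ne_zero hx' (hφ0 hq) hpq.symm
    refine ⟨p, q, hp, hq, ?_, ?_⟩
    · rw [hpq, order_mul hx' (hφ0 hq), order_C, zero_add]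
    · rw [hpq, HahnSeries.leadingCoeff_mul]
      congr 1
      exact leadingCoeff_of_single
  -- If all leading terms were in the class, each residue, a quotient of two leading coefficients of
  -- equal order, would lie in `M`. A polynomial `f` of least degree outside the class plays the
  -- role of a key polynomial.
  have hex : ∃ n : ℕ, ∃ f : K[X], f ≠ 0 ∧ ¬ T f ∧ f.natDegree = n := by
    by_contra! hcon
    apply hne
    rw [eq_top_iff]
    rintro x -
    rcases eq_or_ne x 0 with rfl | hx
    · exact M.zero_mem
    obtain ⟨p, q, hp, hq, ho, hl⟩ := hquot x hx
    have hTp : T p := by_contra fun h ↦ hcon _ p hp h rfl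
    have hTq : T q := by_contra fun h ↦ hcon _ q hq h rfl
    have hTx := InPowerClass.mul hb hTp (InPowerClass.inv hTq)
    rw [ho, add_neg_cancel, hl, mul_inv_cancel_right₀ (hl0 hq)] at hTx
    exact hTx.mem hM hN
  obtain ⟨f, hf0, hTf, hfdeg⟩ := Nat.find_spec hex
  have hmin : ∀ g : K[X], g ≠ 0 → g.natDegree < f.natDegree → T g := by
    intro g hg hlt
    by_contra hTg
    rw [hfdeg] at hlt
    exact Nat.find_min hex hlt ⟨g, hg, hTg, rfl⟩
  have hfpos : 0 < f.natDegree := by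
    by_contra h
    rw [eq_C_of_natDegree_eq_zero (Nat.eq_zero_of_not_pos h)] at hTf hf0
    exact hTf (hTC _ (C_ne_zero.1 hf0))
  set d : ℤ := (φ f).order with hd
  set l : E := (φ f).leadingCoeff with hl
  have hlne : l ≠ 0 := hl0 hf0
  obtain ⟨e, h, he, hh, hdvd⟩ := exists_index_inPowerClass (M := M) hb hN d
  set θ : E := l ^ e / h with hθ
  have hθ0 : θ ≠ 0 := div_ne_zero (pow_ne_zero _ hlne) hh.1
  -- Otherwise the leading term of `f ^ e`, hence by root-closedness that of `f`, would be in the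
  -- class.
  have hθM : θ ∉ M := by
    intro hmem
    apply hTf
    apply InPowerClass.of_pow hM hlne he
    have := (InPowerClass.of_mem (N := N) (b := b) hθ0 hmem).mul hb hh
    rwa [zero_add, hθ, div_mul_cancel₀ _ hh.1] at this
  have hθtr : Transcendental M θ := fun h ↦ hθM (hM θ h)
  -- Two terms of the same order differ by a factor in `M` times a power of `θ`, since `e` divides
  -- the difference of the exponents of `l`.
  have hcomp : ∀ (m m' : ℤ) (g g' : E) (j j' : ℕ), InPowerClass M N b m g →
      InPowerClass M N b m' g' → m + j * d = m' + j' * d →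
      ∃ (z : ℤ) (μ : M), (j : ℤ) - j' = e * z ∧
        g * l ^ j = g' * l ^ j' * ((μ : E) * θ ^ z) := by
    intro m m' g g' j j' hg hg' heq
    have h1 : InPowerClass M N b (((j : ℤ) - j') * d) (g' * g⁻¹) := by
      have := hg'.mul hb hg.inv
      convert this using 1
      linarith
    obtain ⟨z, hz⟩ := hdvd _ _ h1
    have h2 := (hg.mul hb hg'.inv).mul hb (hh.zpow hb z)
    have h3 : m + -m' + z * (e * d) = 0 := by
      have : z * (e * d) = ((j : ℤ) - j') * d := by rw [hz]; ring
      rw [this]; linarith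
    rw [h3] at h2
    refine ⟨z, ⟨_, h2.mem hM hN⟩, hz, ?_⟩
    have h4 : l ^ j = l ^ j' * (l ^ e) ^ z := by
      rw [← zpow_natCast l j, ← zpow_natCast l j', ← zpow_natCast l e, ← zpow_mul,
        ← zpow_add₀ hlne, ← hz]
      congr 1
      ring
    have hg0 := hg'.1
    have hhz : h ^ z ≠ 0 := zpow_ne_zero _ hh.1
    rw [h4, hθ, div_zpow]
    field_simp
  -- Induction along the `f`-adic expansion `p = f * q + r`, where `r` is in the class by minimality
  -- of `f`.
  have hmain : ∀ (n : ℕ) (p : K[X]), p ≠ 0 → p.natDegree = n →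
      ∃ (m : ℤ) (g : E) (j : ℕ) (P : M[X]), InPowerClass M N b m g ∧
        (φ p).order = m + j * d ∧ (φ p).leadingCoeff = g * l ^ j * aeval θ P := by
    intro n
    induction n using Nat.strong_induction_on with
    | _ n ih =>
    intro p hp hpn
    have hsmall : ∀ r : K[X], r ≠ 0 → T r →
        ∃ (m : ℤ) (g : E) (j : ℕ) (P : M[X]), InPowerClass M N b m g ∧
        (φ r).order = m + j * d ∧ (φ r).leadingCoeff = g * l ^ j * aeval θ P :=
      fun r hr hTr ↦ ⟨_, _, 0, 1, hTr, by simp, by simp⟩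
    rcases lt_or_ge p.natDegree f.natDegree with hlt | hge
    · exact hsmall p hp (hmin p hp hlt)
    set q := p / f with hqdef
    set r := p % f with hrdef
    have hpqr : p = f * q + r := (EuclideanDomain.div_add_mod p f).symm
    have hrdeg : r ≠ 0 → r.natDegree < f.natDegree := fun hr ↦
      natDegree_lt_natDegree hr (EuclideanDomain.mod_lt p hf0)
    have hq0 : q ≠ 0 := by
      intro hq0
      rw [hq0, mul_zero, zero_add] at hpqr
      have hr0 : r ≠ 0 := hpqr ▸ hp
      have := hrdeg hr0
      rw [← hpqr] at this
      omega
    have hqdeg : q.natDegree < n := by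
      rw [← hpn]
      exact natDegree_lt_natDegree hq0 (degree_div_lt hp (natDegree_pos_iff_degree_pos.1 hfpos))
    obtain ⟨m, g, j, P, hg, hoq, hlq⟩ := ih _ hqdeg q hq0 rfl
    have hfq0 : φ (f * q) ≠ 0 := hφ0 (mul_ne_zero hf0 hq0)
    have hofq : (φ (f * q)).order = m + (j + 1 : ℕ) * d := by
      rw [map_mul, order_mul (hφ0 hf0) (hφ0 hq0), hoq]
      push_cast
      ring
    have hlfq : (φ (f * q)).leadingCoeff = g * l ^ (j + 1) * aeval θ P := by
      rw [map_mul, HahnSeries.leadingCoeff_mul, hlq]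
      ring
    have hP0 : aeval θ P ≠ 0 := right_ne_zero_of_mul (hlfq ▸ leadingCoeff_ne_zero.2 hfq0)
    rcases eq_or_ne r 0 with hr0 | hr0
    · rw [hr0, add_zero] at hpqr
      exact ⟨m, g, j + 1, P, hg, by rw [hpqr, hofq], by rw [hpqr, hlfq]⟩
    have hTr : T r := hmin r hr0 (hrdeg hr0)
    rcases lt_trichotomy (φ (f * q)).order (φ r).order with hlt | heq | hgt
    · obtain ⟨h1, h2⟩ := order_leadingCoeff_add_of_lt hfq0 (Or.inr hlt)
      rw [← map_add, ← hpqr] at h1 h2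
      exact ⟨m, g, j + 1, P, hg, by rw [h1, hofq], by rw [h2, hlfq]⟩
    · obtain ⟨z, μ, hz, hμ⟩ := hcomp m (φ r).order g (φ r).leadingCoeff (j + 1) 0 hg hTr
        (by rw [← hofq, heq]; simp)
      -- Here `e * z = j + 1`, so `θ` occurs with a positive exponent.
      have hzpos : 0 < z := by
        push_cast at hz
        by_contra hz0
        have : (e : ℤ) * z ≤ 0 := mul_nonpos_of_nonneg_of_nonpos (by omega) (by omega)
        omega
      obtain ⟨i, rfl⟩ : ∃ i : ℕ, z = (i + 1 : ℕ) := ⟨(z - 1).toNat, by omega⟩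
      rw [zpow_natCast, pow_zero, mul_one] at hμ
      -- The constant coefficient of `Q` is 1, so `Q ≠ 0`; as `θ` is transcendental, the two leading
      -- terms cannot cancel.
      let Q : M[X] := Polynomial.C μ * X ^ (i + 1) * P + 1
      have hQ : Q ≠ 0 := by
        intro hQ
        have := congrArg (fun R : M[X] ↦ R.coeff 0) hQ
        simp [Q, pow_succ, mul_coeff_zero] at this
      have hQθ : aeval θ Q ≠ 0 := fun h0 ↦ hθtr ⟨Q, hQ, h0⟩
      have hsum : (φ (f * q)).leadingCoeff + (φ r).leadingCoeff =
          (φ r).leadingCoeff * aeval θ Q := by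
        rw [hlfq, hμ]
        simp only [Q, map_add, map_mul, aeval_C, map_pow, aeval_X, map_one]
        change _ = _ * ((μ : E) * _ * _ + 1)
        ring
      obtain ⟨h1, h2⟩ := order_leadingCoeff_add_of_eq heq
        (by rw [hsum]; exact mul_ne_zero (hl0 hr0) hQθ)
      rw [← map_add, ← hpqr] at h1 h2
      exact ⟨_, _, 0, Q, hTr, by rw [h1, heq]; simp, by rw [h2, hsum]; simp⟩
    · obtain ⟨h1, h2⟩ := order_leadingCoeff_add_of_lt (hφ0 hr0) (Or.inr hgt)
      rw [← map_add, add_comm, ← hpqr] at h1 h2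
      rw [h1, h2]
      exact hsmall r hr0 hTr
  refine ⟨θ, hθtr, ?_⟩
  rw [eq_top_iff]
  rintro x -
  rcases eq_or_ne x 0 with rfl | hx
  · exact zero_mem _
  obtain ⟨p, q, hp, hq, ho, hlx⟩ := hquot x hx
  obtain ⟨m, g, j, P, hg, hop, hlp⟩ := hmain _ p hp rfl
  obtain ⟨m', g', j', Q, hg', hoq, hlq⟩ := hmain _ q hq rfl
  obtain ⟨z, μ, -, hμ⟩ := hcomp m m' g g' j j' hg hg' (by rw [← hop, ← hoq, ho])
  have hx' : x = (μ : E) * θ ^ z * aeval θ P / aeval θ Q := by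
    have hq' := hl0 hq
    have hQ0 : aeval θ Q ≠ 0 := right_ne_zero_of_mul (hlq ▸ hq')
    have hg0 : g' * l ^ j' ≠ 0 := left_ne_zero_of_mul (hlq ▸ hq')
    rw [eq_div_iff hQ0]
    apply mul_left_cancel₀ hg0
    calc g' * l ^ j' * (x * aeval θ Q) = x * (g' * l ^ j' * aeval θ Q) := by ring
      _ = g * l ^ j * aeval θ P := by rw [← hlq, ← hlx, hlp]
      _ = _ := by rw [hμ]; ring
  have hθmem : θ ∈ IntermediateField.adjoin M {θ} := IntermediateField.mem_adjoin_simple_self M θ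
  have hpoly : ∀ P : M[X], aeval θ P ∈ IntermediateField.adjoin M {θ} := fun P ↦
    IntermediateField.algebra_adjoin_le_adjoin M {θ} (aeval_mem_adjoin_singleton M θ)
  rw [hx']
  exact div_mem (mul_mem (mul_mem (IntermediateField.algebraMap_mem _ μ) (zpow_mem hθmem z))
    (hpoly P)) (hpoly Q)

end RuledResidue

/-! ### Lifting algebraically independent residues -/

section TrivialValuation

theorem HahnSeries.exists_ofPowerSeries_of_order_nonneg {E : Type*} [Field E]
    {x : LaurentSeries E} (hx : 0 ≤ x.order) :
    ∃ P : PowerSeries E, ofPowerSeries ℤ E P = x ∧ PowerSeries.constantCoeff P = x.coeff 0 := by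
  obtain ⟨n, hn⟩ := Int.eq_ofNat_of_zero_le hx
  have h := LaurentSeries.X_order_mul_powerSeriesPart (f := x) (n := n) hn.symm
  refine ⟨_, h, ?_⟩
  conv_rhs => rw [← h]
  rw [← PowerSeries.coeff_zero_eq_constantCoeff_apply]
  exact (LaurentSeries.coeff_coe_powerSeries _ 0).symm

variable {k K E : Type*} [Field k] [Field K] [Field E] [Algebra k K] [Algebra k E]

open HahnSeries

/-- Reduction is the constant-coefficient map on power series, a ring homomorphism; so a polynomial
in the lifts `y` reduces to the same polynomial in the residues `x`. -/
theorem exists_ofPowerSeries_aeval (φ : K →+* LaurentSeries E)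
    (hk : ∀ c : k, φ (algebraMap k K c) = HahnSeries.C (algebraMap k E c)) {ι : Type*}
    {x : ι → E} {y : ι → K} (hxy : ∀ i, (φ (y i)).order = 0 ∧ (φ (y i)).leadingCoeff = x i)
    (p : MvPolynomial ι k) :
    ∃ P : PowerSeries E, ofPowerSeries ℤ E P = φ (MvPolynomial.aeval y p) ∧
      PowerSeries.constantCoeff P = MvPolynomial.aeval x p := by
  induction p using MvPolynomial.induction_on with
  | C c =>
    refine ⟨PowerSeries.C (algebraMap k E c), ?_, ?_⟩
    · rw [MvPolynomial.aeval_C, hk, ofPowerSeries_C]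
    · simp
  | add p q hp hq =>
    obtain ⟨P, hP, hP'⟩ := hp
    obtain ⟨Q, hQ, hQ'⟩ := hq
    exact ⟨P + Q, by simp [hP, hQ], by simp [hP', hQ']⟩
  | mul_X p i hp =>
    obtain ⟨P, hP, hP'⟩ := hp
    obtain ⟨Q, hQ, hQ'⟩ := exists_ofPowerSeries_of_order_nonneg (hxy i).1.ge
    have : (φ (y i)).coeff 0 = x i := by rw [← (hxy i).2, HahnSeries.leadingCoeff_eq, (hxy i).1]
    exact ⟨P * Q, by simp [hP, hQ], by simp [hP', hQ', this]⟩

theorem algebraicIndependent_of_residues (φ : K →+* LaurentSeries E)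
    (hk : ∀ c : k, φ (algebraMap k K c) = HahnSeries.C (algebraMap k E c)) {ι : Type*}
    {x : ι → E} {y : ι → K} (hxy : ∀ i, (φ (y i)).order = 0 ∧ (φ (y i)).leadingCoeff = x i)
    (hx : AlgebraicIndependent k x) : AlgebraicIndependent k y := by
  rw [algebraicIndependent_iff] at hx ⊢
  intro p hp
  apply hx
  obtain ⟨P, hP, hP'⟩ := exists_ofPowerSeries_aeval φ hk hxy p
  rw [hp, map_zero, ← map_zero (ofPowerSeries ℤ E)] at hP
  rw [← hP', ofPowerSeries_injective hP, map_zero]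

/-- An element algebraic over a field generated by lifts of algebraically independent residues has
order at most zero. -/
theorem order_nonpos_of_isAlgebraic_adjoin_residues (φ : K →+* LaurentSeries E)
    (hk : ∀ c : k, φ (algebraMap k K c) = HahnSeries.C (algebraMap k E c)) {ι : Type*}
    {x : ι → E} {y : ι → K} (hxy : ∀ i, (φ (y i)).order = 0 ∧ (φ (y i)).leadingCoeff = x i)
    (hx : AlgebraicIndependent k x) {c : K}
    (hc : IsAlgebraic (Algebra.adjoin k (Set.range y)) c) : (φ c).order ≤ 0 := by
  by_contra! hpos
  have hc0 : c ≠ 0 := by rintro rfl; simp at hpos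
  obtain ⟨q, hq0, hq⟩ := hc.exists_nonzero_coeff_and_aeval_eq_zero
    (mem_nonZeroDivisors_of_ne_zero hc0)
  let O : Subring K := (ofPowerSeries ℤ E).range.comap φ
  have hadj : ∀ a : Algebra.adjoin k (Set.range y), ∃ p : MvPolynomial ι k,
      (a : K) = MvPolynomial.aeval y p := by
    rintro ⟨a, ha⟩
    rw [Algebra.adjoin_range_eq_range_aeval] at ha
    obtain ⟨p, hp⟩ := ha
    exact ⟨p, hp.symm⟩
  have hO : ∀ a : Algebra.adjoin k (Set.range y), (a : K) ∈ O := by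
    intro a
    obtain ⟨p, hp⟩ := hadj a
    obtain ⟨P, hP, -⟩ := exists_ofPowerSeries_aeval φ hk hxy p
    exact ⟨P, by rw [hP, hp]⟩
  obtain ⟨Q, hQ, hQ0⟩ := exists_ofPowerSeries_of_order_nonneg hpos.le
  rw [coeff_eq_zero_of_lt_order hpos] at hQ0
  have hcO : c ∈ O := ⟨Q, hQ⟩
  -- Writing the relation as `c * q₁(c) + q(0) = 0` with `q₁(c)` integral, the positive order of `c`
  -- forces the residue of `q(0)` to vanish. By independence of `x`, `q(0) = 0`, a contradiction.
  have hrO : aeval c q.divX ∈ O := by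
    rw [aeval_eq_sum_range]
    refine sum_mem fun i _ ↦ ?_
    rw [Algebra.smul_def]
    exact mul_mem (hO _) (pow_mem hcO i)
  obtain ⟨R, hR⟩ := hrO
  obtain ⟨p, hp⟩ := hadj (q.coeff 0)
  obtain ⟨P, hP, hP'⟩ := exists_ofPowerSeries_aeval φ hk hxy p
  have hsum : aeval c q.divX * c + (q.coeff 0 : K) = 0 := by
    rw [← hq]
    conv_rhs => rw [← divX_mul_X_add q]
    rw [map_add, map_mul, aeval_X, aeval_C]
    rfl
  have hPS : R * Q + P = 0 := by
    apply ofPowerSeries_injective (Γ := ℤ)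
    rw [map_add, map_mul, hR, hQ, hP, ← hp, ← map_mul, ← map_add, hsum, map_zero, map_zero]
  have h0 : MvPolynomial.aeval x p = 0 := by
    have := congrArg PowerSeries.constantCoeff hPS
    rwa [map_add, map_mul, hQ0, mul_zero, zero_add, hP', map_zero] at this
  rw [algebraicIndependent_iff] at hx
  rw [hx p h0, map_zero] at hp
  exact hq0 (Subtype.ext hp)

end TrivialValuation

/-! ### Transcendence degree of the residue field -/

section TrdegResidues

universe u

variable {k : Type*} {K E : Type u} [Field k] [Field K] [Field E] [Algebra k K] [Algebra k E]

open HahnSeries in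
/-- If `E` is algebraic over the field generated by the residues of `K`, and the transcendence
degree of `E` is at least that of `K`, then the valuation is trivial on `K`. -/
theorem order_eq_zero_of_isAlgebraic_adjoin_residues (φ : K →+* LaurentSeries E)
    (hk : ∀ c : k, φ (algebraMap k K c) = HahnSeries.C (algebraMap k E c))
    (hfin : Algebra.trdeg k K < Cardinal.aleph0) (hle : Algebra.trdeg k K ≤ Algebra.trdeg k E)
    (S : Set E) (hS : ∀ x ∈ S, ∃ c : K, (φ c).order = 0 ∧ (φ c).leadingCoeff = x)
    [Algebra.IsAlgebraic (Algebra.adjoin k S) E] (c : K) : (φ c).order = 0 := by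
  obtain ⟨t, htS, ht⟩ := exists_isTranscendenceBasis_subset (R := k) S
  choose y hy using fun x : t ↦ hS x (htS x.2)
  have hyi := algebraicIndependent_of_residues φ hk hy ht.1
  -- Independent lifts as numerous as the transcendence degree of `E` already exhaust that of `K`,
  -- so all of `K` is algebraic over them; the order bound then applies to both `c` and `c⁻¹`.
  have hyb : IsTranscendenceBasis k y := hyi.isTranscendenceBasis_of_trdeg_le hfin
    (hle.trans ht.cardinalMk_eq_trdeg.ge)
  have halg := hyb.isAlgebraic
  have h1 := order_nonpos_of_isAlgebraic_adjoin_residues φ hk hy ht.1 (halg.isAlgebraic c)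
  have h2 := order_nonpos_of_isAlgebraic_adjoin_residues φ hk hy ht.1 (halg.isAlgebraic c⁻¹)
  rcases eq_or_ne c 0 with rfl | hc
  · simp
  have h3 : (φ c * φ c⁻¹).order = 0 := by
    rw [← map_mul, mul_inv_cancel₀ hc, map_one, order_one]
  rw [order_mul ((map_ne_zero φ).2 hc) ((map_ne_zero φ).2 (inv_ne_zero hc))] at h3
  omega

open HahnSeries IntermediateField.algebraAdjoinAdjoin in
/-- If `φ` embeds `K[X]` into the Laurent series over `E` so that `K` has nontrivial value group
and `E` is the residue field of `K(X)`, and `K`, `E` have the same finite transcendence degree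
over `k`, then `E` is purely transcendental of degree one over some field containing `k`. -/
theorem exists_intermediateField_transcendental_adjoin_eq_top (φ : K[X] →+* LaurentSeries E)
    (hφ : Function.Injective φ)
    (hk : ∀ c : k, φ (C (algebraMap k K c)) = HahnSeries.C (algebraMap k E c))
    (hfin : Algebra.trdeg k K < Cardinal.aleph0) (hle : Algebra.trdeg k K ≤ Algebra.trdeg k E)
    (hval : ∃ c : K, (φ (C c)).order ≠ 0)
    (hE : ∀ x : E, ∃ p q : K[X], q ≠ 0 ∧ φ p = HahnSeries.C x * φ q) :
    ∃ (M : IntermediateField k E) (θ : E), Transcendental M θ ∧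
      IntermediateField.adjoin M {θ} = ⊤ := by
  let S : Set E := {x | ∃ c : K, (φ (C c)).order = 0 ∧ (φ (C c)).leadingCoeff = x}
  -- `M` is the algebraic closure in `E` of the field `κ` generated by the residues of `K`.
  let κ := IntermediateField.adjoin k S
  let M : IntermediateField k E := (algebraicClosure κ E).restrictScalars k
  have hmemM : ∀ x : E, x ∈ M ↔ IsAlgebraic κ x := fun x ↦ mem_algebraicClosure_iff
  obtain ⟨θ, hθ, htop⟩ := exists_transcendental_adjoin_eq_top_of_residues φ hφ M.toSubfield
    (fun x hx ↦ by
      have h1 : x ∈ algebraicClosure (algebraicClosure κ E) E := mem_algebraicClosure_iff.2 hx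
      rw [algebraicClosure.algebraicClosure_eq_bot, IntermediateField.mem_bot] at h1
      obtain ⟨z, rfl⟩ := h1
      exact z.2)
    (fun c _ hc ↦ (hmemM _).2 (isAlgebraic_algebraMap
      (⟨_, IntermediateField.subset_adjoin k S ⟨c, hc, rfl⟩⟩ : κ)))
    hval hE
    (fun h ↦ by
      have halg : Algebra.IsAlgebraic κ E :=
        ⟨fun x ↦ (hmemM x).1 (show x ∈ M.toSubfield by rw [h]; trivial)⟩
      have : Algebra.IsAlgebraic (Algebra.adjoin k S) E :=
        (IsFractionRing.comap_isAlgebraic_iff (K := κ)).2 halg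
      obtain ⟨c, hc⟩ := hval
      exact hc (order_eq_zero_of_isAlgebraic_adjoin_residues (φ.comp C) hk hfin hle S
        (fun x hx ↦ hx) c))
  exact ⟨M, θ, hθ, htop⟩

end TrdegResidues

/-! ### Rational function fields and towers -/

section RationalFunctionField

theorem isRationalFunctionField_of_algebraicIndependent {F L : Type*} [Field F] [Field L]
    [Algebra F L] {n : ℕ} {x : Fin n → L} (hx : AlgebraicIndependent F x)
    (htop : IntermediateField.adjoin F (Set.range x) = ⊤) : IsRationalFunctionField n F L :=
  ⟨((hx.aevalEquivField.trans (IntermediateField.equivOfEq htop)).trans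
    IntermediateField.topEquiv).symm⟩

theorem isRationalFunctionField_one_of_transcendental {F L : Type*} [Field F] [Field L]
    [Algebra F L] {θ : L} (hθ : Transcendental F θ)
    (htop : IntermediateField.adjoin F {θ} = ⊤) : IsRationalFunctionField 1 F L :=
  isRationalFunctionField_of_algebraicIndependent (x := fun _ : Fin 1 ↦ θ)
    ((algebraicIndependent_unique_type_iff (ι := Fin 1)).2 hθ) (by rwa [Set.range_const])

theorem exists_isRationalFunctionField_two {k E L : Type*} [Field k] [Field E] [Field L]
    [Algebra k E] [Algebra k L] [Algebra E L] [IsScalarTower k E L] (M : IntermediateField k E)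
    {θ : E} (hθ : Transcendental M θ) (hθgen : IntermediateField.adjoin M {θ} = ⊤)
    {s : L} (hs : Transcendental E s) (hsgen : IntermediateField.adjoin E {s} = ⊤) :
    ∃ K : IntermediateField k L, IsRationalFunctionField 2 K L := by
  let j : E →ₐ[k] L := IsScalarTower.toAlgHom k E L
  -- The base field has to sit inside `L`, so `M` is replaced by its image and independence of `s,
  -- θ` is carried along `f`.
  let K : IntermediateField k L := M.map j
  let f : M →+* K := (j.comp M.val).toRingHom.codRestrict K fun m ↦ ⟨m, m.2, rfl⟩
  have hf : Function.Surjective f := by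
    rintro ⟨_, m, hm, rfl⟩
    exact ⟨⟨m, hm⟩, rfl⟩
  have h1 : AlgebraicIndependent M (Sum.elim (fun _ : Fin 1 ↦ s)
      (algebraMap E L ∘ fun _ : Fin 1 ↦ θ)) :=
    AlgebraicIndependent.sumElim_comp ((algebraicIndependent_unique_type_iff (ι := Fin 1)).2 hθ)
      ((algebraicIndependent_unique_type_iff (ι := Fin 1)).2 hs)
  have h2 := h1.ringHom_of_comp_eq f (RingHom.id L) hf
    Function.injective_id (by ext m; rfl)
  have h3 := h2.comp _ (finSumFinEquiv (m := 1) (n := 1)).symm.injective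
  refine ⟨K, isRationalFunctionField_of_algebraicIndependent h3 ?_⟩
  set W := IntermediateField.adjoin K (Set.range ((⇑(RingHom.id L) ∘ Sum.elim (fun _ : Fin 1 ↦ s)
      (algebraMap E L ∘ fun _ : Fin 1 ↦ θ)) ∘ (finSumFinEquiv (m := 1) (n := 1)).symm)) with hW
  have hsW : s ∈ W := IntermediateField.subset_adjoin _ _ ⟨finSumFinEquiv (Sum.inl 0), by simp⟩
  have hθW : algebraMap E L θ ∈ W :=
    IntermediateField.subset_adjoin _ _ ⟨finSumFinEquiv (Sum.inr 0), by simp⟩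
  have hEW : ∀ x : E, algebraMap E L x ∈ W := by
    intro x
    have hx : x ∈ IntermediateField.adjoin M {θ} := by rw [hθgen]; trivial
    induction hx using IntermediateField.adjoin_induction with
    | mem x hx => rw [Set.mem_singleton_iff.1 hx]; exact hθW
    | algebraMap x => exact IntermediateField.algebraMap_mem W (f x)
    | add x y _ _ hx hy => rw [map_add]; exact add_mem hx hy
    | inv x _ hx => rw [map_inv₀]; exact inv_mem hx
    | mul x y _ _ hx hy => rw [map_mul]; exact mul_mem hx hy
  rw [eq_top_iff]
  rintro x -
  have hx : x ∈ IntermediateField.adjoin E {s} := by rw [hsgen]; trivial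
  induction hx using IntermediateField.adjoin_induction with
  | mem x hx => rw [Set.mem_singleton_iff.1 hx]; exact hsW
  | algebraMap x => exact hEW x
  | add x y _ _ hx hy => exact add_mem hx hy
  | inv x _ hx => exact inv_mem hx
  | mul x y _ _ hx hy => exact mul_mem hx hy

end RationalFunctionField

/-! ### The degree valuation at infinity -/

section InverseVariable

variable (E : Type*) [Field E]

/-- The embedding of `E[X]` into Laurent series sending `X` to the inverse of the uniformizer. -/
noncomputable def polynomialToLaurentInv : E[X] →+* LaurentSeries E :=
  eval₂RingHom HahnSeries.C (HahnSeries.single (-1) 1)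

variable {E}

theorem polynomialToLaurentInv_C (x : E) : polynomialToLaurentInv E (C x) = HahnSeries.C x := by
  simp [polynomialToLaurentInv]

theorem coeff_polynomialToLaurentInv (p : E[X]) (n : ℤ) :
    (polynomialToLaurentInv E p).coeff n = if n ≤ 0 then p.coeff n.natAbs else 0 := by
  induction p using Polynomial.induction_on' with
  | add p q hp hq => rw [map_add, HahnSeries.coeff_add, hp, hq, coeff_add]; split_ifs <;> simp
  | monomial m a =>
    have : polynomialToLaurentInv E (monomial m a) = HahnSeries.single (-(m : ℤ)) a := by
      simp [polynomialToLaurentInv, eval₂_monomial, HahnSeries.single_pow,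
        HahnSeries.C_apply, HahnSeries.single_mul_single]
    rw [this, HahnSeries.coeff_single, coeff_monomial]
    split_ifs <;> first | rfl | omega

theorem order_polynomialToLaurentInv {p : E[X]} (hp : p ≠ 0) :
    (polynomialToLaurentInv E p).order = -p.natDegree := by
  have hc : (polynomialToLaurentInv E p).coeff (-p.natDegree) ≠ 0 := by
    rw [coeff_polynomialToLaurentInv, if_pos (by omega), Int.natAbs_neg, Int.natAbs_natCast]
    exact leadingCoeff_ne_zero.2 hp
  have hne : polynomialToLaurentInv E p ≠ 0 := by
    intro h
    rw [h] at hc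
    exact hc rfl
  apply le_antisymm (HahnSeries.order_le_of_coeff_ne_zero hc)
  rw [HahnSeries.le_order_iff_forall hne]
  intro n hn
  rw [coeff_polynomialToLaurentInv]
  split_ifs
  · exact coeff_eq_zero_of_natDegree_lt (by omega)
  · rfl

theorem polynomialToLaurentInv_injective : Function.Injective (polynomialToLaurentInv E) := by
  rw [injective_iff_map_eq_zero]
  intro p hp
  ext n
  have := coeff_polynomialToLaurentInv p (-n)
  rw [hp, if_pos (by omega), Int.natAbs_neg, Int.natAbs_natCast] at this
  simpa using this.symm

end InverseVariable

/-! ### Members of `A1star B` as generic lines -/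

section Line

variable {k B : Type*} [Field k] [CommRing B] [IsDomain B] [Algebra k B]

/-- The map `g : B → (Frac A)[X]` exhibits `(Frac A)[X]` as the localization of `B` at the nonzero
elements of `A`, and `A` is algebraically closed in `B`. -/
structure IsGenericLine (A : Subalgebra k B) (g : B →ₐ[k] (FractionRing A)[X]) : Prop where
  injective : Function.Injective g
  map_coe : ∀ a : A, g a = C (algebraMap A (FractionRing A) a)
  exists_mul_eq : ∀ p : (FractionRing A)[X], ∃ (b : B) (a : A), a ≠ 0 ∧ g a * p = g b
  mem_of_isAlgebraic : ∀ b : B, IsAlgebraic A b → b ∈ A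

theorem A1star.exists_ringHom {A : Subring B} (hA : A ∈ A1star B) :
    ∃ g : B →+* (FractionRing A)[X], Function.Injective g ∧
      (∀ a : A, g a = C (algebraMap A (FractionRing A) a)) ∧
      (∀ p : (FractionRing A)[X], ∃ (b : B) (a : A), a ≠ 0 ∧ g a * p = g b) := by
  obtain ⟨-, ⟨σ⟩⟩ := hA
  have hle : Algebra.algebraMapSubmonoid B A⁰ ≤ B⁰ := by
    rintro _ ⟨a, ha, rfl⟩
    exact mem_nonZeroDivisors_of_ne_zero fun h ↦ nonZeroDivisors.ne_zero ha (Subtype.ext h)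
  have hmap : ∀ a : A, σ (algebraMap B (locAt A) a) = C (algebraMap A (FractionRing A) a) := by
    intro a
    have h1 : algebraMap B (locAt A) a =
        algebraMap (FractionRing A) (locAt A) (algebraMap A (FractionRing A) a) := by
      rw [← IsScalarTower.algebraMap_apply A (FractionRing A) (locAt A),
        IsScalarTower.algebraMap_apply A B (locAt A)]
      rfl
    rw [h1, σ.commutes, algebraMap_eq]
  refine ⟨(σ : locAt A →+* (FractionRing A)[X]).comp (algebraMap B (locAt A)),
    σ.injective.comp (IsLocalization.injective _ hle), hmap, fun p ↦ ?_⟩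
  obtain ⟨⟨b, ⟨_, a, ha, rfl⟩⟩, hb⟩ :=
    IsLocalization.surj (Algebra.algebraMapSubmonoid B A⁰) (σ.symm p)
  refine ⟨b, a, nonZeroDivisors.ne_zero ha, ?_⟩
  have := congrArg σ hb
  rw [map_mul, σ.apply_symm_apply, mul_comm] at this
  exact this

/-- Fields in `B` lie in each member of `A1star B`, as the units of a polynomial ring over a field
are constant. -/
theorem A1star.algebraMap_mem {A : Subring B} (hA : A ∈ A1star B) (c : k) :
    algebraMap k B c ∈ A := by
  obtain ⟨g, hg, hgA, -⟩ := A1star.exists_ringHom hA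
  rcases eq_or_ne c 0 with rfl | hc
  · rw [map_zero]; exact A.zero_mem
  have hu : IsUnit (g (algebraMap k B c)) := ((IsUnit.mk0 c hc).map (algebraMap k B)).map g
  obtain ⟨x, -, hx⟩ := Polynomial.isUnit_iff.1 hu
  obtain ⟨a, s, hs, rfl⟩ := IsFractionRing.div_surjective (A := A) x
  apply hA.1
  have hs0 : (algebraMap A (FractionRing A) s) ≠ 0 :=
    IsFractionRing.to_map_ne_zero_of_mem_nonZeroDivisors hs
  have h1 : (s : B) * algebraMap k B c = a := by
    apply hg
    rw [map_mul, hgA, hgA, ← hx, ← C_mul, mul_div_cancel₀ _ hs0]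
  refine ⟨C s * X - C a, ?_, ?_⟩
  · intro h
    have := congrArg (fun p ↦ coeff p 1) h
    simp at this
    exact nonZeroDivisors.ne_zero hs this
  · simp only [map_sub, map_mul, aeval_C, aeval_X]
    exact sub_eq_zero.2 h1

theorem A1star.exists_isGenericLine {A : Subalgebra k B} (hA : A.toSubring ∈ A1star B) :
    ∃ g, IsGenericLine A g := by
  obtain ⟨g, hg, hgA, hgs⟩ := A1star.exists_ringHom hA
  -- The subring and the subalgebra have the same elements, but their fraction rings are different
  -- types; `e` passes between them.
  let e : FractionRing A.toSubring ≃+* FractionRing A :=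
    IsFractionRing.ringEquivOfRingEquiv (A := A.toSubring) (B := A) (RingEquiv.refl A)
  have he : ∀ a : A, e (algebraMap A.toSubring (FractionRing A.toSubring) a) =
    algebraMap A (FractionRing A) a := fun a ↦ IsFractionRing.ringEquivOfRingEquiv_algebraMap _ _
  let g' : B →+* (FractionRing A)[X] := (mapEquiv e : _ →+* _).comp g
  have hg'A : ∀ a : A, g' a = C (algebraMap A (FractionRing A) a) := by
    intro a
    change (g a).map (e : FractionRing A.toSubring →+* FractionRing A) = _
    rw [hgA a, map_C]
    exact congrArg C (he a)
  refine ⟨⟨g', fun c ↦ ?_⟩, (mapEquiv e).injective.comp hg, hg'A, fun p ↦ ?_, hA.1⟩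
  · exact hg'A (algebraMap k A c)
  · obtain ⟨b, a, ha, hab⟩ := hgs ((mapEquiv e).symm p)
    refine ⟨b, a, ha, ?_⟩
    have := congrArg (mapEquiv e) hab
    rwa [map_mul, RingEquiv.apply_symm_apply] at this

end Line

universe u

/-! ### Transcendence degrees of fraction fields -/

section Trdeg

theorem trdeg_eq_of_isFractionRing (k : Type*) [Field k] (R F : Type u) [CommRing R] [IsDomain R]
    [Field F] [Algebra k R] [Algebra k F] [Algebra R F] [IsScalarTower k R F]
    [IsFractionRing R F] : Algebra.trdeg k F = Algebra.trdeg k R := by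
  have : Algebra.IsAlgebraic R F := IsFractionRing.comap_isAlgebraic_iff.2
    (inferInstance : Algebra.IsAlgebraic F F)
  have : FaithfulSMul R F :=
    (faithfulSMul_iff_algebraMap_injective R F).2 (IsFractionRing.injective R F)
  rw [← trdeg_add_eq k R (A := F), trdeg_eq_zero (R := R), add_zero]

theorem trdeg_ratFunc (k : Type*) (E : Type u) [Field k] [Field E] [Algebra k E] :
    Algebra.trdeg k (RatFunc E) = Algebra.trdeg k E + 1 := by
  rw [trdeg_eq_of_isFractionRing k E[X], ← trdeg_add_eq k E (A := E[X]),
    Polynomial.trdeg_of_isDomain]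

end Trdeg

/-! ### Comparing two generic lines -/

section GenericLine

variable {k : Type*} {B : Type u} [Field k] [CommRing B] [IsDomain B] [Algebra k B]
  {A : Subalgebra k B} {g : B →ₐ[k] (FractionRing A)[X]}

namespace IsGenericLine

theorem exists_algEquiv_ratFunc (h : IsGenericLine A g) :
    ∃ τ : FractionRing B ≃ₐ[k] RatFunc (FractionRing A),
      ∀ b, τ (algebraMap B (FractionRing B) b) = algebraMap _ _ (g b) := by
  let γ : B →ₐ[k] RatFunc (FractionRing A) :=
    (IsScalarTower.toAlgHom k (FractionRing A)[X] (RatFunc (FractionRing A))).comp g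
  have hγ : Function.Injective γ := (IsFractionRing.injective (FractionRing A)[X] _).comp h.injective
  let τ : FractionRing B →ₐ[k] RatFunc (FractionRing A) := IsFractionRing.liftAlgHom hγ
  have hτ : ∀ b, τ (algebraMap B (FractionRing B) b) = γ b := fun b ↦
    IsFractionRing.lift_algebraMap hγ b
  have hsurj : ∀ p : (FractionRing A)[X], ∃ x, τ x = algebraMap _ _ p := by
    intro p
    obtain ⟨b, a, ha, hab⟩ := h.exists_mul_eq p
    refine ⟨algebraMap _ _ b / algebraMap _ _ (a : B), ?_⟩
    have ha0 : γ a ≠ 0 := (map_ne_zero_iff γ hγ).2 fun h0 ↦ ha (Subtype.ext h0)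
    rw [map_div₀, hτ, hτ, div_eq_iff ha0, mul_comm]
    change algebraMap (FractionRing A)[X] (RatFunc (FractionRing A)) (g b) =
      algebraMap (FractionRing A)[X] (RatFunc (FractionRing A)) (g a) * algebraMap _ _ p
    rw [← hab, map_mul]
  refine ⟨AlgEquiv.ofBijective τ ⟨τ.toRingHom.injective, fun z ↦ ?_⟩, hτ⟩
  obtain ⟨p, q, -, rfl⟩ := IsFractionRing.div_surjective (A := (FractionRing A)[X]) z
  obtain ⟨x, hx⟩ := hsurj p
  obtain ⟨y, hy⟩ := hsurj q
  exact ⟨x / y, by rw [map_div₀, hx, hy]⟩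

/-- Ring homomorphisms from `B` to a field extend along a generic line. -/
theorem exists_lift (h : IsGenericLine A g) {L : Type*} [Field L] (ψ : B →+* L)
    (hψ : Function.Injective ψ) :
    ∃ φ : (FractionRing A)[X] →+* L, Function.Injective φ ∧ ∀ b, φ (g b) = ψ b := by
  obtain ⟨τ, hτ⟩ := h.exists_algEquiv_ratFunc
  let Φ : FractionRing B →+* L := IsFractionRing.lift hψ
  refine ⟨(Φ.comp τ.symm.toRingEquiv.toRingHom).comp
      (algebraMap (FractionRing A)[X] (RatFunc (FractionRing A))),
    (RingHom.injective (Φ.comp _)).comp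
      (IsFractionRing.injective (FractionRing A)[X] (RatFunc (FractionRing A))), fun b ↦ ?_⟩
  change Φ (τ.symm (algebraMap _ _ (g b))) = _
  rw [← hτ, τ.symm_apply_apply]
  exact IsFractionRing.lift_algebraMap hψ b

theorem trdeg_add_one (h : IsGenericLine A g) :
    Algebra.trdeg k A + 1 = Algebra.trdeg k (FractionRing B) := by
  obtain ⟨τ, -⟩ := h.exists_algEquiv_ratFunc
  rw [τ.trdeg_eq, trdeg_ratFunc, trdeg_eq_of_isFractionRing k A (FractionRing A)]

/-- A constant `a / s` gives the relation `s * b = a`, so `b` is algebraic over `A`. -/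
theorem mem_of_natDegree_eq_zero (h : IsGenericLine A g) {b : B} (hb : (g b).natDegree = 0) :
    b ∈ A := by
  obtain ⟨a, s, hs, hx⟩ := IsFractionRing.div_surjective (A := A) ((g b).coeff 0)
  have hs0 : (algebraMap A (FractionRing A) s) ≠ 0 :=
    IsFractionRing.to_map_ne_zero_of_mem_nonZeroDivisors hs
  have h1 : (s : B) * b = a := by
    apply h.injective
    rw [map_mul, h.map_coe, h.map_coe, eq_C_of_natDegree_eq_zero hb, ← hx, ← C_mul,
      mul_div_cancel₀ _ hs0]
  apply h.mem_of_isAlgebraic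
  refine ⟨C s * X - C a, ?_, ?_⟩
  · intro h
    have := congrArg (fun p ↦ coeff p 1) h
    simp at this
    exact nonZeroDivisors.ne_zero hs this
  · simp only [map_sub, map_mul, aeval_C, aeval_X]
    exact sub_eq_zero.2 h1

/-- Two members of `A1star B` one of which contains the other are equal. -/
theorem eq_of_le {A' : Subalgebra k B} {g' : B →ₐ[k] (FractionRing A')[X]}
    (h : IsGenericLine A g) (h' : IsGenericLine A' g')
    (htrdeg : Algebra.trdeg k (FractionRing B) < Cardinal.aleph0) (hle : A' ≤ A) : A' = A := by
  apply le_antisymm hle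
  have heq := Cardinal.add_one_inj.1 (h.trdeg_add_one.trans h'.trdeg_add_one.symm)
  have hfin : Algebra.trdeg k A' < Cardinal.aleph0 :=
    (self_le_add_right _ _).trans_lt (h'.trdeg_add_one.trans_lt htrdeg)
  let : Algebra A' A := (Subalgebra.inclusion hle).toAlgebra
  have : IsScalarTower k A' A := .of_algebraMap_eq fun _ ↦ rfl
  have : FaithfulSMul A' A :=
    (faithfulSMul_iff_algebraMap_injective A' A).2 (Subalgebra.inclusion_injective hle)
  -- Both rings have transcendence degree one less than `Frac B`; finiteness allows cancellation, so
  -- `A` is algebraic over `A'`.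
  have h0 : Algebra.trdeg A' A = 0 := by
    have := trdeg_add_eq k A' (A := A)
    rw [heq] at this
    exact Cardinal.eq_of_add_eq_add_left (this.trans (add_zero _).symm) hfin
  have halg := trdeg_eq_zero_iff.1 h0
  intro a ha
  apply h'.mem_of_isAlgebraic
  have : IsScalarTower A' A B := .of_algebraMap_eq fun _ ↦ rfl
  exact (halg.isAlgebraic (⟨a, ha⟩ : A)).algebraMap (A := B)

/-- In the presence of a second member of `A1star B`, the fraction field of `A` is purely
transcendental of degree one over a field containing `k`. -/
theorem exists_transcendental_adjoin_eq_top {A' : Subalgebra k B}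
    {g' : B →ₐ[k] (FractionRing A')[X]} (h : IsGenericLine A g) (h' : IsGenericLine A' g')
    (htrdeg : Algebra.trdeg k (FractionRing B) < Cardinal.aleph0) (hne : A' ≠ A) :
    ∃ (M : IntermediateField k (FractionRing A)) (θ : FractionRing A), Transcendental M θ ∧
      IntermediateField.adjoin M {θ} = ⊤ := by
  let ψ : B →+* LaurentSeries (FractionRing A) :=
    (polynomialToLaurentInv (FractionRing A)).comp (g : B →+* (FractionRing A)[X])
  have hψ : Function.Injective ψ := polynomialToLaurentInv_injective.comp h.injective
  -- The valuation `-deg` of the line over `A`, seen on the polynomial ring over `Frac A'`.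
  obtain ⟨φ, hφ, hφg⟩ := h'.exists_lift ψ hψ
  have hψA : ∀ a : A, ψ a = HahnSeries.C (algebraMap A (FractionRing A) a) := by
    intro a
    change polynomialToLaurentInv _ (g a) = _
    rw [h.map_coe, polynomialToLaurentInv_C]
  have htr : Algebra.trdeg k (FractionRing A') = Algebra.trdeg k (FractionRing A) := by
    rw [trdeg_eq_of_isFractionRing k A', trdeg_eq_of_isFractionRing k A]
    exact Cardinal.add_one_inj.1 (h'.trdeg_add_one.trans h.trdeg_add_one.symm)
  refine exists_intermediateField_transcendental_adjoin_eq_top φ hφ ?_ ?_ htr.le ?_ ?_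
  · intro c
    have h1 := hφg (algebraMap k B c)
    have h2 := hψA (algebraMap k A c)
    have h3 := h'.map_coe (algebraMap k A' c)
    change g' (algebraMap k B c) = _ at h3
    rw [h3] at h1
    exact h1.trans h2
  · rw [trdeg_eq_of_isFractionRing k A']
    exact (self_le_add_right _ _).trans_lt (h'.trdeg_add_one.trans_lt htrdeg)
  -- Order zero on `Frac A'` means that elements of `A'` have degree 0 along the line of `A`, so `A'
  -- ≤ A`.
  · by_contra! hcon
    apply hne
    apply h.eq_of_le h' htrdeg
    intro a ha
    apply h.mem_of_natDegree_eq_zero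
    rcases eq_or_ne a 0 with rfl | ha0
    · simp
    have h1 := hcon (algebraMap A' (FractionRing A') ⟨a, ha⟩)
    rw [← h'.map_coe, hφg] at h1
    change (polynomialToLaurentInv _ (g a)).order = 0 at h1
    rw [order_polynomialToLaurentInv ((map_ne_zero_iff g h.injective).2 ha0)] at h1
    omega
  -- Elements of `A` become constant series, so `x = a / s` is the residue of `g' a / g' s`.
  · intro x
    obtain ⟨a, s, hs, rfl⟩ := IsFractionRing.div_surjective (A := A) x
    have hs0 : (algebraMap A (FractionRing A) s) ≠ 0 :=
      IsFractionRing.to_map_ne_zero_of_mem_nonZeroDivisors hs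
    refine ⟨g' a, g' s, (map_ne_zero_iff g' h'.injective).2
      fun h0 ↦ nonZeroDivisors.ne_zero hs (Subtype.ext h0), ?_⟩
    rw [hφg, hφg, hψA, hψA, ← map_mul, div_mul_cancel₀ _ hs0]

theorem exists_isRationalFunctionField_two (h : IsGenericLine A g)
    {M : IntermediateField k (FractionRing A)} {θ : FractionRing A} (hθ : Transcendental M θ)
    (htop : IntermediateField.adjoin M {θ} = ⊤) :
    ∃ K : IntermediateField k (FractionRing B),
      IsRationalFunctionField 2 K (FractionRing B) := by
  obtain ⟨τ, -⟩ := h.exists_algEquiv_ratFunc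
  let : Algebra (FractionRing A) (FractionRing B) :=
    ((τ.symm : RatFunc (FractionRing A) →+* FractionRing B).comp
      (algebraMap (FractionRing A) (RatFunc (FractionRing A)))).toAlgebra
  have : IsScalarTower k (FractionRing A) (FractionRing B) := .of_algebraMap_eq fun c ↦ by
    change _ = τ.symm (algebraMap _ _ (algebraMap k (FractionRing A) c))
    rw [← IsScalarTower.algebraMap_apply, τ.symm.commutes]
  let τ' : RatFunc (FractionRing A) ≃ₐ[FractionRing A] FractionRing B :=
    AlgEquiv.ofRingEquiv (f := τ.symm.toRingEquiv) fun _ ↦ rfl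
  refine _root_.exists_isRationalFunctionField_two M hθ htop (s := τ' RatFunc.X) ?_ ?_
  · exact fun h0 ↦ RatFunc.transcendental_X
      ((isAlgebraic_algHom_iff τ'.toAlgHom τ'.injective).1 h0)
  · have := congrArg (IntermediateField.map τ'.toAlgHom)
      (RatFunc.adjoin_X (K := FractionRing A))
    rw [IntermediateField.adjoin_map, Set.image_singleton] at this
    refine this.trans (eq_top_iff.2 ?_)
    rintro x -
    exact ⟨τ'.symm x, trivial, τ'.apply_symm_apply x⟩

end IsGenericLine

end GenericLine

/-! ### The proposition -/

theorem mainTheorem4 {k B : Type*} [Field k] [CommRing B] [IsDomain B] [Algebra k B]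
    (htrdeg : Algebra.trdeg k (FractionRing B) < Cardinal.aleph0)
    (hcard : 1 < (A1star B).encard) :
    (∀ A ∈ A1star B, ∃ hk : ∀ c : k, algebraMap k B c ∈ A,
      IsRuled k (FractionRing ({ A with algebraMap_mem' := hk } : Subalgebra k B))) ∧
    (∃ K : IntermediateField k (FractionRing B),
      IsRationalFunctionField 2 K (FractionRing B)) := by
  have key : ∀ (A A' : Subring B) (hA : A ∈ A1star B), A' ∈ A1star B → A' ≠ A →
      ∃ (g : B →ₐ[k] (FractionRing ({ A with
            algebraMap_mem' := A1star.algebraMap_mem hA } : Subalgebra k B))[X])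
        (M : IntermediateField k (FractionRing ({ A with
            algebraMap_mem' := A1star.algebraMap_mem hA } : Subalgebra k B)))
        (θ : FractionRing ({ A with
            algebraMap_mem' := A1star.algebraMap_mem hA } : Subalgebra k B)),
        IsGenericLine _ g ∧ Transcendental M θ ∧ IntermediateField.adjoin M {θ} = ⊤ := by
    intro A A' hA hA' hne
    let S : Subalgebra k B := { A with algebraMap_mem' := A1star.algebraMap_mem hA }
    let S' : Subalgebra k B := { A' with algebraMap_mem' := A1star.algebraMap_mem hA' }
    obtain ⟨g, hg⟩ := A1star.exists_isGenericLine (A := S) hA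
    obtain ⟨g', hg'⟩ := A1star.exists_isGenericLine (A := S') hA'
    obtain ⟨M, θ, hθ, htop⟩ := hg.exists_transcendental_adjoin_eq_top hg' htrdeg
      fun h ↦ hne (congrArg Subalgebra.toSubring h)
    exact ⟨g, M, θ, hg, hθ, htop⟩
  obtain ⟨A₁, A₂, h₁, h₂, hne⟩ := Set.one_lt_encard_iff.1 hcard
  constructor
  · intro A hA
    obtain ⟨A', hA', hne'⟩ : ∃ A' ∈ A1star B, A' ≠ A := by
      by_cases h : A₁ = A
      · exact ⟨A₂, h₂, fun h' ↦ hne (h.trans h'.symm)⟩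
      · exact ⟨A₁, h₁, h⟩
    obtain ⟨-, M, θ, -, hθ, htop⟩ := key A A' hA hA' hne'
    exact ⟨A1star.algebraMap_mem hA, M, isRationalFunctionField_one_of_transcendental hθ htop⟩
  · obtain ⟨g, M, θ, hg, hθ, htop⟩ := key A₁ A₂ h₁ h₂ (Ne.symm hne)
    exact hg.exists_isRationalFunctionField_two hθ htop
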